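/- Let $1\le j\le n$ be integers. Write $\mathcal W_2(\mathbb R^n)$ for the Borel probability measures on $\mathbb R^n$ with finite second moment, and $\mathcal W_{2,ac}(\mathbb R^n)$ for those that are absolutely continuous with respect to Lebesgue measure. Let $W_2(\sigma,\mu)=\inf_\pi\left(\int\|x-y\|^2\,d\pi(x,y)\right)^{1/2}$, the infimum over all couplings $\pi$ of $\sigma$ and $\mu$. For $\theta\in S^{n-1}$ let $\sigma^\theta$ be the pushforward of $\sigma$ by $x\mapsto x\cdot\theta$. For measures $\alpha,\beta$ on $\mathbb R$ let $T_\alpha^\beta$ be an optimal transport map from $\alpha$ to $\beta$, i.e. a minimizer of $\int|T(x)-x|^2\,d\alpha(x)$ over the measurable maps $T$ with $T_\sharp\alpha=\beta$ (any fixed choice of one; if none exists, which cannot happen for absolutely continuous $\alpha$ with $\alpha,\beta$ of finite second moment, put $T_\alpha^\beta=\operatorname{id}$). For an orthogonal matrix $P=[\theta_1,\dots,\theta_n]\in O(n)$ the $j$-slice matching map is $$T^j_{\sigma,\mu;P}(x)=\sum_{i=1}^j T_{\sigma^{\theta_i}}^{\mu^{\theta_i}}(x\cdot\theta_i)\,\theta_i+\sum_{i=j+1}^n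 (x\cdot\theta_i)\,\theta_i .$$ Let $\sigma_0\in\mathcal W_{2,ac}(\mathbb R^n)$ and $\mu\in\mathcal W_2(\mathbb R^n)$, let $P_k=[\theta_1^k,\dots,\theta_n^k]\in O(n)$ and $\gamma_k\in[0,1]$ for $k\ge 0$, and let $$\sigma_{k+1}=\left((1-\gamma_k)\operatorname{id}+\gamma_k T^j_{\sigma_k,\mu;P_k}\right)_\sharp\sigma_k,\qquad k\ge 0 .$$ Then for every $k\ge 0$ with $\sigma_k\in\mathcal W_{2,ac}(\mathbb R^n)$, $$W_2^2(\sigma_{k+1},\sigma_k)=\gamma_k^2\sum_{i=1}^j W_2^2\left(\sigma_k^{\theta_i^k},\mu^{\theta_i^k}\right).$$ -/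

import Mathlib

open MeasureTheory
open scoped ENNReal

noncomputable section

namespace SliceMatching

section General

variable {E : Type*} [NormedAddCommGroup E] [MeasurableSpace E]

/-- The space `𝒲₂`: probability measures with finite second moment. -/
def MemW2 (σ : Measure E) : Prop :=
  IsProbabilityMeasure σ ∧ ∫⁻ x, ‖x‖ₑ ^ 2 ∂σ < ∞

/-- `Γ(σ, μ)`: measures on the product with marginals `σ` and `μ`. -/
def couplings (σ μ : Measure E) : Set (Measure (E × E)) :=
  {π | π.map Prod.fst = σ ∧ π.map Prod.snd = μ}

/-- The quadratic Wasserstein distance, as an extended nonnegative real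
(it is finite on `𝒲₂`). -/
def W2 (σ μ : Measure E) : ℝ≥0∞ :=
  ⨅ π ∈ couplings σ μ, (∫⁻ p, ‖p.1 - p.2‖ₑ ^ 2 ∂π) ^ (1 / 2 : ℝ)

/-- `T` is an optimal transport map from `σ` to `μ`: it minimizes the quadratic cost
`∫ ‖T x - x‖² dσ` among all maps pushing `σ` forward to `μ`. -/
def IsOptimalTransportMap (σ μ : Measure E) (T : E → E) : Prop :=
  Measurable T ∧ σ.map T = μ ∧
    ∀ S : E → E, Measurable S → σ.map S = μ →
      ∫⁻ x, ‖T x - x‖ₑ ^ 2 ∂σ ≤ ∫⁻ x, ‖S x - x‖ₑ ^ 2 ∂σ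

open Classical in
/-- An optimal transport map `T_σ^μ` (with the identity as a default value when there is
none; for absolutely continuous `σ ∈ 𝒲₂` and `μ ∈ 𝒲₂` there is one, unique `σ`-a.e.). -/
def otMap (σ μ : Measure E) : E → E :=
  if h : ∃ T, IsOptimalTransportMap σ μ T then h.choose else id

end General

/-- The space `𝒲_{2,ac}(ℝⁿ)`. -/
def MemW2ac {n : ℕ} (σ : Measure (EuclideanSpace ℝ (Fin n))) : Prop :=
  MemW2 σ ∧ σ ≪ volume

/-- The `i`-th column `θ_i` of an orthogonal matrix `P = [θ_1, …, θ_n]`, as a vector of `ℝⁿ`. -/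
def column {n : ℕ} (P : Matrix.orthogonalGroup (Fin n) ℝ) (i : Fin n) :
    EuclideanSpace ℝ (Fin n) :=
  WithLp.toLp 2 (fun a => (P : Matrix (Fin n) (Fin n) ℝ) a i)

/-- The projected measure `σ^θ`, the pushforward of `σ` by `x ↦ x · θ`. -/
def slice {n : ℕ} (σ : Measure (EuclideanSpace ℝ (Fin n))) (θ : EuclideanSpace ℝ (Fin n)) :
    Measure ℝ :=
  σ.map (fun x => inner ℝ x θ)

/-- The `j`-slice matching map `T^j_{σ,μ;P}`; the columns of `P` are indexed from `0`, so the
first `j` of them are those with index `< j`. -/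
def sliceMatchingMap {n : ℕ} (σ μ : Measure (EuclideanSpace ℝ (Fin n)))
    (P : Matrix.orthogonalGroup (Fin n) ℝ) (j : ℕ) (x : EuclideanSpace ℝ (Fin n)) :
    EuclideanSpace ℝ (Fin n) :=
  (∑ i ∈ Finset.univ.filter (fun i : Fin n => i.val < j),
      otMap (slice σ (column P i)) (slice μ (column P i)) (inner ℝ x (column P i)) • column P i) +
    ∑ i ∈ Finset.univ.filter (fun i : Fin n => j ≤ i.val), (inner ℝ x (column P i) : ℝ) • column P i

/-- The iteration `σ_{k+1} = ((1 - γ_k) id + γ_k T^j_{σ_k,μ;P_k})_♯ σ_k` started at `σ₀`. -/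
def sliceIter {n : ℕ} (σ₀ μ : Measure (EuclideanSpace ℝ (Fin n)))
    (P : ℕ → Matrix.orthogonalGroup (Fin n) ℝ) (γ : ℕ → ℝ) (j : ℕ) :
    ℕ → Measure (EuclideanSpace ℝ (Fin n))
  | 0 => σ₀
  | k + 1 =>
    (sliceIter σ₀ μ P γ j k).map
      (fun x => (1 - γ k) • x +
        γ k • sliceMatchingMap (sliceIter σ₀ μ P γ j k) μ (P k) j x)

end SliceMatching

end

namespace SliceMatching

open Set ProbabilityTheory Filter

/-! Upper bound: the step map couples `σ_k` with `σ_{k+1}`. Its displacement has coordinate `γ (T_i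
t - t)` along each matched column and `0` along the others, so by Pythagoras its cost is `γ²` times
the sum of the one-dimensional costs, each equal to the squared slice distance (`lintegral_otMap`).

Lower bound: projecting any coupling to the columns shows that `W2 ^ 2` dominates the sum of the
squared slice distances (`sum_W2_slice_sq_le`). Along a matched column, the slice of `σ_{k+1}` is
the displacement interpolation of the slice of `σ_k`, which has moved at least `γ W2` by the
triangle inequality (`mul_W2_le_W2_interpolation`).

The input from the line is that, for an atomless source, an optimal map exists and is optimal among
all couplings. Monotone rearrangement gives this. -/

theorem W2_le_of_mem_couplings {E : Type*} [NormedAddCommGroup E] [MeasurableSpace E]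
    {σ μ : Measure E} {π : Measure (E × E)} (hπ : π ∈ couplings σ μ) :
    W2 σ μ ≤ (∫⁻ p, ‖p.1 - p.2‖ₑ ^ 2 ∂π) ^ (1 / 2 : ℝ) :=
  iInf₂_le π hπ

theorem rpow_half_sq (a : ℝ≥0∞) : (a ^ (1 / 2 : ℝ)) ^ 2 = a := by
  rw [← ENNReal.rpow_natCast, ← ENNReal.rpow_mul]; norm_num

theorem W2_sq_le_of_mem_couplings {E : Type*} [NormedAddCommGroup E] [MeasurableSpace E]
    {σ μ : Measure E} {π : Measure (E × E)} (hπ : π ∈ couplings σ μ) :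
    W2 σ μ ^ 2 ≤ ∫⁻ p, ‖p.1 - p.2‖ₑ ^ 2 ∂π :=
  (pow_le_pow_left' (W2_le_of_mem_couplings hπ) 2).trans_eq (rpow_half_sq _)

theorem le_W2_sq {E : Type*} [NormedAddCommGroup E] [MeasurableSpace E]
    {σ μ : Measure E} {c : ℝ≥0∞}
    (h : ∀ π ∈ couplings σ μ, c ≤ ∫⁻ p, ‖p.1 - p.2‖ₑ ^ 2 ∂π) : c ≤ W2 σ μ ^ 2 := by
  rw [← rpow_half_sq c]
  refine pow_le_pow_left' (le_iInf₂ fun π hπ => ?_) 2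
  exact ENNReal.rpow_le_rpow (h π hπ) (by norm_num)

theorem map_prodMk_mem_couplings {E Ω : Type*} [NormedAddCommGroup E] [MeasurableSpace E]
    [MeasurableSpace Ω] {m : Measure Ω} {f g : Ω → E} (hf : Measurable f) (hg : Measurable g) :
    m.map (fun x => (f x, g x)) ∈ couplings (m.map f) (m.map g) :=
  ⟨by rw [Measure.map_map measurable_fst (hf.prodMk hg)]; rfl,
    by rw [Measure.map_map measurable_snd (hf.prodMk hg)]; rfl⟩

theorem W2_sq_map_le {E Ω : Type*} [NormedAddCommGroup E] [MeasurableSpace E] [BorelSpace E]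
    [SecondCountableTopology E] [MeasurableSpace Ω] {m : Measure Ω} {f g : Ω → E}
    (hf : Measurable f) (hg : Measurable g) :
    W2 (m.map f) (m.map g) ^ 2 ≤ ∫⁻ x, ‖f x - g x‖ₑ ^ 2 ∂m := by
  refine (W2_sq_le_of_mem_couplings (map_prodMk_mem_couplings hf hg)).trans_eq ?_
  rw [lintegral_map (by fun_prop) (hf.prodMk hg)]

/-! ### Quadratic cost on the line -/

section Line

/-- The squared distance is the area of a square with side `|x - y|`; at most one of the two squares
is nonempty. -/
theorem enorm_sub_sq_eq_lintegral (x y : ℝ) :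
    ‖x - y‖ₑ ^ 2 = ∫⁻ q : ℝ × ℝ, ((Ico x y ×ˢ Ico x y).indicator 1 q +
      (Ico y x ×ˢ Ico y x).indicator 1 q) := by
  rw [lintegral_add_left
      (measurable_one.indicator (measurableSet_Ico.prod measurableSet_Ico)),
    lintegral_indicator_one (measurableSet_Ico.prod measurableSet_Ico),
    lintegral_indicator_one (measurableSet_Ico.prod measurableSet_Ico),
    Measure.volume_eq_prod, Measure.prod_prod, Measure.prod_prod, Real.volume_Ico,
    Real.volume_Ico, Real.enorm_eq_ofReal_abs]
  rcases le_total x y with h | h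
  · rw [ENNReal.ofReal_of_nonpos (sub_nonpos.2 h), abs_sub_comm, abs_of_nonneg (sub_nonneg.2 h)]
    ring
  · rw [ENNReal.ofReal_of_nonpos (sub_nonpos.2 h), abs_of_nonneg (sub_nonneg.2 h)]
    ring

/-- Tonelli applied to the square formula: the cost sees `π` only through the masses of quadrants,
which can be compared one at a time. -/
theorem lintegral_enorm_sub_sq_eq (π : Measure (ℝ × ℝ)) [SFinite π] :
    ∫⁻ p, ‖p.1 - p.2‖ₑ ^ 2 ∂π = ∫⁻ q : ℝ × ℝ,
      (π {p | p.1 ≤ min q.1 q.2 ∧ max q.1 q.2 < p.2} +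
        π {p | p.2 ≤ min q.1 q.2 ∧ max q.1 q.2 < p.1}) := by
  simp_rw [enorm_sub_sq_eq_lintegral]
  have h1 : MeasurableSet {z : (ℝ × ℝ) × (ℝ × ℝ) |
      z.1.1 ≤ min z.2.1 z.2.2 ∧ max z.2.1 z.2.2 < z.1.2} := by
    rw [ofPred_and]
    exact (measurableSet_le (by fun_prop) (by fun_prop)).inter
      (measurableSet_lt (by fun_prop) (by fun_prop))
  have h2 : MeasurableSet {z : (ℝ × ℝ) × (ℝ × ℝ) |
      z.1.2 ≤ min z.2.1 z.2.2 ∧ max z.2.1 z.2.2 < z.1.1} := by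
    rw [ofPred_and]
    exact (measurableSet_le (by fun_prop) (by fun_prop)).inter
      (measurableSet_lt (by fun_prop) (by fun_prop))
  have key : ∀ p q : ℝ × ℝ, (Ico p.1 p.2 ×ˢ Ico p.1 p.2).indicator (1 : ℝ × ℝ → ℝ≥0∞) q +
      (Ico p.2 p.1 ×ˢ Ico p.2 p.1).indicator 1 q =
      {z : (ℝ × ℝ) × (ℝ × ℝ) | z.1.1 ≤ min z.2.1 z.2.2 ∧ max z.2.1 z.2.2 < z.1.2}.indicator 1
        (p, q) +
      {z : (ℝ × ℝ) × (ℝ × ℝ) | z.1.2 ≤ min z.2.1 z.2.2 ∧ max z.2.1 z.2.2 < z.1.1}.indicator 1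
        (p, q) := by
    intro p q
    simp only [indicator, mem_prod, mem_Ico, mem_ofPred_eq, le_min_iff, max_lt_iff]
    congr 2 <;> simp only [eq_iff_iff] <;> tauto
  simp_rw [key]
  rw [lintegral_lintegral_swap (((measurable_one.indicator h1).add
    (measurable_one.indicator h2)).aemeasurable)]
  refine lintegral_congr fun q => ?_
  have e1 : MeasurableSet {p : ℝ × ℝ | p.1 ≤ min q.1 q.2 ∧ max q.1 q.2 < p.2} :=
    measurable_prodMk_right (y := q) h1
  have e2 : MeasurableSet {p : ℝ × ℝ | p.2 ≤ min q.1 q.2 ∧ max q.1 q.2 < p.1} :=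
    measurable_prodMk_right (y := q) h2
  rw [← lintegral_indicator_one e1, ← lintegral_indicator_one e2,
    ← lintegral_add_left (measurable_one.indicator e1)]
  rfl

/-- Among couplings of measures on the line, comonotone ones have the least quadratic cost. -/
theorem lintegral_enorm_sub_sq_le_of_comonotone {α β : Measure ℝ} [IsFiniteMeasure α]
    {π₀ π : Measure (ℝ × ℝ)} (hπ₀ : π₀ ∈ couplings α β) (hπ : π ∈ couplings α β)
    (h1 : ∀ u v, π₀ {p | p.1 ≤ u ∧ v < p.2} ≤ α (Iic u) - β (Iic v))
    (h2 : ∀ u v, π₀ {p | p.2 ≤ u ∧ v < p.1} ≤ β (Iic u) - α (Iic v)) :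
    ∫⁻ p, ‖p.1 - p.2‖ₑ ^ 2 ∂π₀ ≤ ∫⁻ p, ‖p.1 - p.2‖ₑ ^ 2 ∂π := by
  have fin : ∀ ρ ∈ couplings α β, IsFiniteMeasure ρ := by
    rintro ρ ⟨rfl, -⟩
    exact Measure.isFiniteMeasure_of_map measurable_fst.aemeasurable
  have := fin _ hπ₀
  have := fin _ hπ
  have hα : ∀ u, α (Iic u) = π {p | p.1 ≤ u} := fun u => by
    rw [← hπ.1, Measure.map_apply measurable_fst measurableSet_Iic]; rfl
  have hβ : ∀ u, β (Iic u) = π {p | p.2 ≤ u} := fun u => by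
    rw [← hπ.2, Measure.map_apply measurable_snd measurableSet_Iic]; rfl
  rw [lintegral_enorm_sub_sq_eq, lintegral_enorm_sub_sq_eq]
  -- The marginals alone force every coupling to give each quadrant at least the difference of the
  -- distribution functions.
  refine lintegral_mono fun q => add_le_add ((h1 _ _).trans ?_) ((h2 _ _).trans ?_)
  · rw [hα, hβ]
    refine le_measure_sdiff.trans (measure_mono fun p hp => ⟨hp.1, not_le.1 hp.2⟩)
  · rw [hα, hβ]
    refine le_measure_sdiff.trans (measure_mono fun p hp => ⟨hp.1, not_le.1 hp.2⟩)

/-- Lower sets of the line are nested, so the difference is either empty or proper subtraction. -/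
theorem measure_diff_le_of_isLowerSet {α : Measure ℝ} [IsFiniteMeasure α] {s t : Set ℝ}
    (hs : IsLowerSet s) (ht : IsLowerSet t) : α (s \ t) ≤ α s - α t := by
  rcases hs.total ht with h | h
  · simp [sdiff_eq_empty.2 h]
  · exact (measure_sdiff h ht.ordConnected.measurableSet.nullMeasurableSet
      (measure_ne_top _ _)).le

/-- A map whose sublevel sets are, up to null sets, lower sets is an optimal coupling. -/
theorem lintegral_enorm_sub_sq_le_of_sublevel {α : Measure ℝ} [IsFiniteMeasure α] {T : ℝ → ℝ}
    (hT : Measurable T) (hlow : ∀ v, ∃ s, IsLowerSet s ∧ {x | T x ≤ v} =ᵐ[α] s)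
    {π : Measure (ℝ × ℝ)} (hπ : π ∈ couplings α (α.map T)) :
    ∫⁻ x, ‖T x - x‖ₑ ^ 2 ∂α ≤ ∫⁻ p, ‖p.1 - p.2‖ₑ ^ 2 ∂π := by
  have hm : Measurable fun x => (x, T x) := measurable_id.prodMk hT
  have h0 := map_prodMk_mem_couplings (m := α) measurable_id hT
  rw [Measure.map_id] at h0
  simp only [id] at h0
  have hmeas1 : ∀ u v : ℝ, MeasurableSet {p : ℝ × ℝ | p.1 ≤ u ∧ v < p.2} := by
    intro u v
    rw [ofPred_and]
    exact (measurableSet_le (by fun_prop) (by fun_prop)).inter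
      (measurableSet_lt (by fun_prop) (by fun_prop))
  have hmeas2 : ∀ u v : ℝ, MeasurableSet {p : ℝ × ℝ | p.2 ≤ u ∧ v < p.1} := by
    intro u v
    rw [ofPred_and]
    exact (measurableSet_le (by fun_prop) (by fun_prop)).inter
      (measurableSet_lt (by fun_prop) (by fun_prop))
  have hβ : ∀ v, α.map T (Iic v) = α {x | T x ≤ v} := fun v =>
    Measure.map_apply hT measurableSet_Iic
  refine le_trans (le_of_eq ?_) (lintegral_enorm_sub_sq_le_of_comonotone h0 hπ ?_ ?_)
  · rw [lintegral_map (by fun_prop) hm]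
    simp_rw [enorm_sub_rev]
  · intro u v
    obtain ⟨s, hs, he⟩ := hlow v
    rw [hβ, Measure.map_apply hm (hmeas1 u v), measure_congr he]
    refine le_trans (le_of_eq ?_) (measure_diff_le_of_isLowerSet (isLowerSet_Iic u) hs)
    have : (Iic u \ {x | T x ≤ v} : Set ℝ) =ᵐ[α] (Iic u \ s : Set ℝ) :=
      (ae_eq_refl _).diff he
    rw [← measure_congr this]
    congr 1
    ext x
    simp
  · intro u v
    obtain ⟨s, hs, he⟩ := hlow u
    rw [hβ, Measure.map_apply hm (hmeas2 u v), measure_congr he]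
    refine le_trans (le_of_eq ?_) (measure_diff_le_of_isLowerSet hs (isLowerSet_Iic v))
    have : ({x | T x ≤ u} \ Iic v : Set ℝ) =ᵐ[α] (s \ Iic v : Set ℝ) :=
      he.diff (ae_eq_refl _)
    rw [← measure_congr this]
    congr 1
    ext x
    simp

/-! ### Monotone rearrangement of an atomless measure -/

theorem continuous_cdf (α : Measure ℝ) [IsProbabilityMeasure α] [NullSingletonClass α] :
    Continuous (cdf α) := by
  rw [continuous_iff_continuousAt]
  intro x
  rw [(monotone_cdf α).continuousAt_iff_leftLim_eq_rightLim, StieltjesFunction.rightLim_eq]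
  have h := (cdf α).measure_singleton x
  rw [measure_cdf, measure_singleton, eq_comm, ENNReal.ofReal_eq_zero, sub_nonpos] at h
  exact le_antisymm ((monotone_cdf α).leftLim_le le_rfl) h

/-- Probability integral transform: for `0 < p < 1` the sublevel set is a half-line `Iic s`, and
continuity gives `cdf α s = p`. -/
theorem measure_cdf_le (α : Measure ℝ) [IsProbabilityMeasure α] [NullSingletonClass α] {p : ℝ}
    (hp0 : 0 ≤ p) (hp1 : p ≤ 1) : α {x | cdf α x ≤ p} = ENNReal.ofReal p := by
  have key : ∀ p : ℝ, 0 < p → p < 1 → α {x | cdf α x ≤ p} = ENNReal.ofReal p := by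
    intro p h0 h1
    have hc := continuous_cdf α
    obtain ⟨b, hb⟩ := ((tendsto_cdf_atTop α).eventually (lt_mem_nhds h1)).exists
    obtain ⟨a, ha⟩ := ((tendsto_cdf_atBot α).eventually (gt_mem_nhds h0)).exists
    have hbdd : BddAbove {x | cdf α x ≤ p} :=
      ⟨b, fun x hx => le_of_not_gt fun hbx => (hb.trans_le (monotone_cdf α hbx.le)).not_ge hx⟩
    have hne : {x | cdf α x ≤ p}.Nonempty := ⟨a, ha.le⟩
    have hcl : IsClosed {x | cdf α x ≤ p} := isClosed_le hc continuous_const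
    set s := sSup {x | cdf α x ≤ p} with hs
    have hmem : cdf α s ≤ p := hcl.csSup_mem hne hbdd
    have hset : {x | cdf α x ≤ p} = Iic s := by
      ext x
      exact ⟨fun hx => le_csSup hbdd hx, fun hx => (monotone_cdf α hx).trans hmem⟩
    have hval : cdf α s = p := by
      obtain ⟨c, hcp⟩ : p ∈ range (cdf α) :=
        mem_range_of_exists_le_of_exists_ge hc ⟨a, ha.le⟩ ⟨b, hb.le⟩
      exact le_antisymm hmem (hcp ▸ monotone_cdf α (le_csSup hbdd hcp.le))
    rw [hset, ← ofReal_cdf, hval]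
  rcases hp1.eq_or_lt with rfl | hp1
  · have : {x | cdf α x ≤ 1} = univ := eq_univ_of_forall fun x => cdf_le_one α x
    simp [this]
  rcases hp0.eq_or_lt with rfl | hp0
  -- At level `0` the set may be empty, so it is squeezed by small positive levels.
  · rw [ENNReal.ofReal_zero, ← nonpos_iff_eq_zero]
    refine ENNReal.le_of_forall_pos_le_add fun ε hε _ => ?_
    have hmin : (0 : ℝ) < min ε (1 / 2) := lt_min (by exact_mod_cast hε) (by norm_num)
    refine (measure_mono fun x (hx : cdf α x ≤ 0) => hx.trans hmin.le).trans
      ((key _ hmin ((min_le_right _ _).trans_lt (by norm_num))).le.trans ?_)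
    rw [zero_add, ← ENNReal.ofReal_coe_nnreal]
    exact ENNReal.ofReal_le_ofReal (min_le_left _ _)
  · exact key p hp0 hp1

theorem ae_cdf_mem_Ioo (α : Measure ℝ) [IsProbabilityMeasure α] [NullSingletonClass α] :
    ∀ᵐ x ∂α, cdf α x ∈ Ioo (0 : ℝ) 1 := by
  have h0 : ∀ᵐ x ∂α, 0 < cdf α x := by
    rw [ae_iff]
    simpa using measure_cdf_le α le_rfl zero_le_one
  have h1 : ∀ᵐ x ∂α, cdf α x < 1 := by
    rw [ae_iff, ← nonpos_iff_eq_zero]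
    refine ENNReal.le_of_forall_pos_le_add fun ε hε _ => ?_
    have hmin : (0 : ℝ) < min ε 1 := lt_min (by exact_mod_cast hε) (by norm_num)
    have hm := measure_cdf_le α (p := 1 - min ε 1) (by simp) (by linarith)
    have hms : MeasurableSet {x | cdf α x ≤ 1 - min ε 1} :=
      measurableSet_le (monotone_cdf α).measurable measurable_const
    have hsub : {x | ¬ cdf α x < 1} ⊆ {x | cdf α x ≤ 1 - min ε 1}ᶜ := fun x hx => by
      simp only [mem_ofPred_eq, not_lt, mem_compl_iff, not_le] at *
      linarith
    refine (measure_mono hsub).trans ?_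
    rw [prob_compl_eq_one_sub hms, hm, ← ENNReal.ofReal_one,
      ← ENNReal.ofReal_sub _ (by simp), zero_add, ← ENNReal.ofReal_coe_nnreal]
    refine ENNReal.ofReal_le_ofReal ?_
    simp
  filter_upwards [h0, h1] with x hx0 hx1 using ⟨hx0, hx1⟩

open Classical in
/-- The monotone rearrangement from `α` to `β`: the quantile function of `β` composed with the
distribution function of `α` (and `0` where the latter takes the values `0` or `1`). -/
noncomputable def monotoneMap (α β : Measure ℝ) (x : ℝ) : ℝ :=
  if cdf α x ∈ Ioo (0 : ℝ) 1 then sInf {y | cdf α x ≤ cdf β y} else 0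

/-- Galois property of quantiles: a level strictly between `0` and `1` makes the infimum genuine,
and right continuity of `cdf β` makes it attained. -/
theorem monotoneMap_le_iff {α β : Measure ℝ} {x y : ℝ}
    (hx : cdf α x ∈ Ioo (0 : ℝ) 1) : monotoneMap α β x ≤ y ↔ cdf α x ≤ cdf β y := by
  rw [monotoneMap, if_pos hx]
  obtain ⟨a, ha⟩ := ((tendsto_cdf_atBot β).eventually (gt_mem_nhds hx.1)).exists
  obtain ⟨b, hb⟩ := ((tendsto_cdf_atTop β).eventually (lt_mem_nhds hx.2)).exists
  have hbdd : BddBelow {y | cdf α x ≤ cdf β y} :=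
    ⟨a, fun z hz => le_of_not_gt fun hza => (ha.trans_le hz).not_ge (monotone_cdf β hza.le)⟩
  have hne : {y | cdf α x ≤ cdf β y}.Nonempty := ⟨b, hb.le⟩
  refine ⟨fun h => ?_, fun h => csInf_le hbdd h⟩
  have hgt : ∀ z, y < z → cdf α x ≤ cdf β z := fun z hz => by
    obtain ⟨w, hw, hwz⟩ := exists_lt_of_csInf_lt hne (h.trans_lt hz)
    exact le_trans hw (monotone_cdf β hwz.le)
  have hcont : Tendsto (cdf β) (nhdsWithin y (Ioi y)) (nhds (cdf β y)) :=
    ((cdf β).right_continuous y).mono_left (nhdsWithin_mono _ Ioi_subset_Ici_self)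
  exact ge_of_tendsto hcont (eventually_nhdsWithin_of_forall hgt)

theorem measurable_monotoneMap (α β : Measure ℝ) : Measurable (monotoneMap α β) := by
  have hg : MeasurableSet {x | cdf α x ∈ Ioo (0 : ℝ) 1} :=
    (monotone_cdf α).measurable measurableSet_Ioo
  refine measurable_of_Iic fun y => ?_
  have : monotoneMap α β ⁻¹' Iic y =
      ({x | cdf α x ∈ Ioo (0 : ℝ) 1} ∩ {x | cdf α x ≤ cdf β y}) ∪
        ({x | cdf α x ∈ Ioo (0 : ℝ) 1}ᶜ ∩ {_x | 0 ≤ y}) := by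
    ext x
    by_cases hx : cdf α x ∈ Ioo (0 : ℝ) 1
    · simp only [mem_preimage, mem_Iic, monotoneMap_le_iff hx]
      simp [-mem_Ioo, hx]
    · simp [-mem_Ioo, monotoneMap, hx]
  rw [this]
  exact (hg.inter (measurableSet_le (monotone_cdf α).measurable measurable_const)).union
    (hg.compl.inter (MeasurableSet.const _))

theorem monotoneMap_sublevel_ae_eq (α β : Measure ℝ) [IsProbabilityMeasure α] [NullSingletonClass α]
    (y : ℝ) : {x | monotoneMap α β x ≤ y} =ᵐ[α] {x | cdf α x ≤ cdf β y} := by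
  filter_upwards [ae_cdf_mem_Ioo α] with x hx
  exact propext (monotoneMap_le_iff hx)

theorem map_monotoneMap (α β : Measure ℝ) [IsProbabilityMeasure α] [NullSingletonClass α]
    [IsProbabilityMeasure β] : α.map (monotoneMap α β) = β := by
  have := Measure.isProbabilityMeasure_map (μ := α) (measurable_monotoneMap α β).aemeasurable
  refine Measure.ext_of_Iic _ _ fun y => ?_
  rw [Measure.map_apply (measurable_monotoneMap α β) measurableSet_Iic]
  refine (measure_congr (monotoneMap_sublevel_ae_eq α β y)).trans ?_
  rw [measure_cdf_le α (cdf_nonneg β y) (cdf_le_one β y), ofReal_cdf]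

theorem lintegral_monotoneMap_le {α β : Measure ℝ} [IsProbabilityMeasure α] [NullSingletonClass α]
    [IsProbabilityMeasure β] :
    ∫⁻ x, ‖monotoneMap α β x - x‖ₑ ^ 2 ∂α ≤ W2 α β ^ 2 := by
  refine le_W2_sq fun π hπ => lintegral_enorm_sub_sq_le_of_sublevel (measurable_monotoneMap α β)
    (fun v => ⟨_, ?_, monotoneMap_sublevel_ae_eq α β v⟩) ?_
  · exact fun a b hba ha => (monotone_cdf α hba).trans ha
  · rwa [map_monotoneMap]

theorem W2_sq_le_of_map_eq {α β : Measure ℝ} {S : ℝ → ℝ} (hS : Measurable S)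
    (h : α.map S = β) : W2 α β ^ 2 ≤ ∫⁻ x, ‖S x - x‖ₑ ^ 2 ∂α := by
  have h1 := W2_sq_map_le (m := α) measurable_id hS
  rw [Measure.map_id, h] at h1
  simpa only [id, enorm_sub_rev] using h1

theorem isOptimalTransportMap_otMap (α β : Measure ℝ) [IsProbabilityMeasure α] [NullSingletonClass α]
    [IsProbabilityMeasure β] : IsOptimalTransportMap α β (otMap α β) := by
  have h : ∃ T, IsOptimalTransportMap α β T :=
    ⟨monotoneMap α β, measurable_monotoneMap α β, map_monotoneMap α β, fun _ hS hSm =>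
      lintegral_monotoneMap_le.trans (W2_sq_le_of_map_eq hS hSm)⟩
  rw [otMap, dif_pos h]
  exact h.choose_spec

/-- The chosen map costs no more than the monotone one, which beats every coupling; uniqueness is
not needed. -/
theorem lintegral_otMap (α β : Measure ℝ) [IsProbabilityMeasure α] [NullSingletonClass α]
    [IsProbabilityMeasure β] : ∫⁻ x, ‖otMap α β x - x‖ₑ ^ 2 ∂α = W2 α β ^ 2 := by
  obtain ⟨hm, hmap, hopt⟩ := isOptimalTransportMap_otMap α β
  exact le_antisymm ((hopt _ (measurable_monotoneMap α β) (map_monotoneMap α β)).trans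
    lintegral_monotoneMap_le) (W2_sq_le_of_map_eq hm hmap)

end Line

/-! ### Triangle inequality and interpolation for `W2` -/

/-- Gluing lemma: two couplings with a common first marginal come from one measure. -/
theorem exists_gluing {X Y Z : Type*} [MeasurableSpace X] [MeasurableSpace Y] [MeasurableSpace Z]
    [StandardBorelSpace Y] [Nonempty Y] [StandardBorelSpace Z] [Nonempty Z]
    (π : Measure (X × Y)) (ρ : Measure (X × Z)) [IsFiniteMeasure π] [IsFiniteMeasure ρ]
    (h : π.map Prod.fst = ρ.map Prod.fst) :
    ∃ m : Measure (X × Y × Z), m.map (fun z => (z.1, z.2.1)) = π ∧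
      m.map (fun z => (z.1, z.2.2)) = ρ := by
  -- Given the common coordinate, the other two are drawn independently from their conditional laws.
  refine ⟨π.fst ⊗ₘ (π.condKernel ×ₖ ρ.condKernel), ?_, ?_⟩
  · have := Measure.compProd_map (μ := π.fst) (κ := π.condKernel ×ₖ ρ.condKernel) measurable_fst
    rw [← Kernel.fst_eq, Kernel.fst_prod, Measure.disintegrate] at this
    exact this.symm
  · have := Measure.compProd_map (μ := π.fst) (κ := π.condKernel ×ₖ ρ.condKernel) measurable_snd
    rw [← Kernel.snd_eq, Kernel.snd_prod, show π.fst = ρ.fst from h, Measure.disintegrate] at this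
    rw [show π.fst = ρ.fst from h]
    exact this.symm

/-- Triangle inequality for `W2`, in the form with both distances measured from `ν`. -/
theorem W2_le_add {E : Type*} [NormedAddCommGroup E] [MeasurableSpace E] [BorelSpace E]
    [SecondCountableTopology E] [CompleteSpace E] {ν α β : Measure E} [IsFiniteMeasure ν] :
    W2 α β ≤ W2 ν α + W2 ν β := by
  have fin : ∀ (τ : Measure E), ∀ ρ ∈ couplings ν τ, IsFiniteMeasure ρ := by
    rintro τ ρ ⟨h, -⟩
    have : IsFiniteMeasure (ρ.map Prod.fst) := h ▸ inferInstance
    exact Measure.isFiniteMeasure_of_map measurable_fst.aemeasurable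
  have key : ∀ π ∈ couplings ν α, ∀ ρ ∈ couplings ν β, W2 α β ≤
      (∫⁻ p, ‖p.1 - p.2‖ₑ ^ 2 ∂π) ^ (1 / 2 : ℝ) +
        (∫⁻ p, ‖p.1 - p.2‖ₑ ^ 2 ∂ρ) ^ (1 / 2 : ℝ) := by
    intro π hπ ρ hρ
    have := fin _ _ hπ
    have := fin _ _ hρ
    obtain ⟨m, rfl, rfl⟩ := exists_gluing π ρ (hπ.1.trans hρ.1.symm)
    have hc := map_prodMk_mem_couplings (m := m) (f := fun z => z.2.1) (g := fun z => z.2.2)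
      (by fun_prop) (by fun_prop)
    have h1 : m.map (fun z => z.2.1) = α := by
      rw [← hπ.2, Measure.map_map measurable_snd (by fun_prop)]; rfl
    have h2 : m.map (fun z => z.2.2) = β := by
      rw [← hρ.2, Measure.map_map measurable_snd (by fun_prop)]; rfl
    rw [h1, h2] at hc
    refine (W2_le_of_mem_couplings hc).trans ?_
    rw [lintegral_map (by fun_prop) (by fun_prop), lintegral_map (by fun_prop) (by fun_prop),
      lintegral_map (by fun_prop) (by fun_prop)]
    have := ENNReal.lintegral_Lp_add_le (μ := m) (p := 2) (f := fun z => ‖z.1 - z.2.1‖ₑ)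
      (g := fun z => ‖z.1 - z.2.2‖ₑ) (by fun_prop) (by fun_prop) (by norm_num)
    simp only [ENNReal.rpow_two, Pi.add_apply] at this
    refine le_trans (ENNReal.rpow_le_rpow (lintegral_mono fun z => ?_) (by norm_num)) this
    refine pow_le_pow_left' ?_ 2
    calc ‖z.2.1 - z.2.2‖ₑ = ‖(z.2.1 - z.1) + (z.1 - z.2.2)‖ₑ := by congr 1; abel
      _ ≤ _ := (enorm_add_le _ _).trans_eq (by rw [enorm_sub_rev z.2.1])
  unfold W2 at key ⊢
  rw [ENNReal.iInf_add]
  refine le_iInf fun π => ?_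
  rw [ENNReal.iInf_add]
  refine le_iInf fun hπ => ?_
  rw [ENNReal.add_iInf]
  refine le_iInf fun ρ => ?_
  rw [ENNReal.add_iInf]
  exact le_iInf fun hρ => key π hπ ρ hρ

theorem W2_lt_top {E : Type*} [NormedAddCommGroup E] [MeasurableSpace E] [BorelSpace E]
    [SecondCountableTopology E] {α β : Measure E} (hα : MemW2 α) (hβ : MemW2 β) :
    W2 α β < ∞ := by
  have := hα.1
  have := hβ.1
  have hc : α.prod β ∈ couplings α β :=
    ⟨by rw [Measure.map_fst_prod]; simp, by rw [Measure.map_snd_prod]; simp⟩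
  refine (W2_le_of_mem_couplings hc).trans_lt (ENNReal.rpow_lt_top_of_nonneg (by norm_num) ?_)
  refine ne_of_lt (lt_of_le_of_lt (lintegral_mono fun p => ?_)
    (b := ∫⁻ p, (2 * ‖p.1‖ₑ ^ 2 + 2 * ‖p.2‖ₑ ^ 2) ∂(α.prod β)) ?_)
  · refine (pow_le_pow_left' enorm_sub_le 2).trans ?_
    have := ENNReal.rpow_add_le_mul_rpow_add_rpow ‖p.1‖ₑ ‖p.2‖ₑ (p := 2) (by norm_num)
    norm_num at this
    rwa [mul_add] at this
  · rw [lintegral_add_left (by fun_prop), lintegral_const_mul _ (by fun_prop),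
      lintegral_const_mul _ (by fun_prop)]
    have h1 : ∫⁻ p, ‖p.1‖ₑ ^ 2 ∂(α.prod β) = ∫⁻ x, ‖x‖ₑ ^ 2 ∂α := by
      conv_rhs => rw [← hc.1]
      rw [lintegral_map (by fun_prop) measurable_fst]
    have h2 : ∫⁻ p, ‖p.2‖ₑ ^ 2 ∂(α.prod β) = ∫⁻ x, ‖x‖ₑ ^ 2 ∂β := by
      conv_rhs => rw [← hc.2]
      rw [lintegral_map (by fun_prop) measurable_snd]
    rw [h1, h2]
    exact ENNReal.add_lt_top.2 ⟨ENNReal.mul_lt_top (by simp) hα.2,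
      ENNReal.mul_lt_top (by simp) hβ.2⟩

/-- Displacement interpolation along an optimal map travels at constant speed
(lower bound on the distance from the starting point). -/
theorem mul_W2_le_W2_interpolation {E : Type*} [NormedAddCommGroup E] [NormedSpace ℝ E]
    [MeasurableSpace E] [BorelSpace E] [SecondCountableTopology E] [CompleteSpace E]
    {α β : Measure E} [IsFiniteMeasure α] {T : E → E} (hT : Measurable T) (hmap : α.map T = β)
    (hcost : ∫⁻ x, ‖T x - x‖ₑ ^ 2 ∂α = W2 α β ^ 2) (hfin : W2 α β ≠ ∞) {γ : ℝ}
    (hγ : γ ∈ Icc (0 : ℝ) 1) :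
    ENNReal.ofReal γ * W2 α β ≤ W2 (α.map fun x => (1 - γ) • x + γ • T x) α := by
  have hS : Measurable fun x => (1 - γ) • x + γ • T x := by fun_prop
  have h1γ : (0 : ℝ) ≤ 1 - γ := sub_nonneg.2 hγ.2
  -- Following `T` covers the remaining distance at cost at most `(1 - γ) W2 α β`; finiteness then
  -- allows cancelling this from the triangle inequality.
  have hlast : W2 (α.map fun x => (1 - γ) • x + γ • T x) β ≤ ENNReal.ofReal (1 - γ) * W2 α β := by
    rw [← ENNReal.pow_le_pow_left_iff two_ne_zero, mul_pow, ← hcost,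
      ← lintegral_const_mul _ (by fun_prop)]
    conv_lhs => rw [← hmap]
    refine (W2_sq_map_le hS hT).trans_eq (lintegral_congr fun x => ?_)
    rw [← mul_pow, ← Real.enorm_of_nonneg h1γ, ← enorm_smul, ← enorm_neg]
    congr 2
    module
  have htri := (W2_le_add (ν := α.map fun x => (1 - γ) • x + γ • T x) (α := α) (β := β)).trans
    (add_le_add_right hlast _)
  have hsplit : W2 α β = ENNReal.ofReal γ * W2 α β + ENNReal.ofReal (1 - γ) * W2 α β := by
    rw [← add_mul, ← ENNReal.ofReal_add hγ.1 h1γ]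
    simp
  refine (ENNReal.add_le_add_iff_right
    (ENNReal.mul_ne_top (ENNReal.ofReal_ne_top (r := 1 - γ)) hfin)).1 ?_
  exact hsplit.symm.le.trans htri

/-! ### Slices along an orthonormal frame -/

section Slices

variable {n : ℕ}

theorem orthonormal_column (P : Matrix.orthogonalGroup (Fin n) ℝ) : Orthonormal ℝ (column P) := by
  rw [orthonormal_iff_ite]
  intro i k
  have h := congrFun (congrFun ((Matrix.mem_orthogonalGroup_iff' (Fin n) ℝ).1 P.2) i) k
  rw [Matrix.mul_apply, Matrix.one_apply] at h
  rw [← h]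
  simp [column, PiLp.inner_apply, mul_comm]

/-- The columns of an orthogonal matrix as an orthonormal basis. -/
noncomputable def columnBasis (P : Matrix.orthogonalGroup (Fin n) ℝ) :
    OrthonormalBasis (Fin n) ℝ (EuclideanSpace ℝ (Fin n)) :=
  OrthonormalBasis.mk (orthonormal_column P)
    ((orthonormal_column P).linearIndependent.span_eq_top_of_card_eq_finrank'
      (by simp)).ge

theorem columnBasis_apply (P : Matrix.orthogonalGroup (Fin n) ℝ) (i : Fin n) :
    columnBasis P i = column P i := by
  simp [columnBasis]

theorem enorm_sq_eq_sum_inner (P : Matrix.orthogonalGroup (Fin n) ℝ)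
    (x : EuclideanSpace ℝ (Fin n)) :
    ‖x‖ₑ ^ 2 = ∑ i, ‖(inner ℝ x (column P i) : ℝ)‖ₑ ^ 2 := by
  have h := (columnBasis P).sum_sq_norm_inner_left x
  simp_rw [columnBasis_apply] at h
  simp_rw [← ofReal_norm, ← ENNReal.ofReal_pow (norm_nonneg _)]
  rw [← h, ENNReal.ofReal_sum_of_nonneg fun _ _ => by positivity]

theorem measurable_inner_left (θ : EuclideanSpace ℝ (Fin n)) :
    Measurable fun x : EuclideanSpace ℝ (Fin n) => (inner ℝ x θ : ℝ) := by
  fun_prop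

theorem isProbabilityMeasure_slice {σ : Measure (EuclideanSpace ℝ (Fin n))}
    [IsProbabilityMeasure σ] (θ : EuclideanSpace ℝ (Fin n)) :
    IsProbabilityMeasure (slice σ θ) :=
  Measure.isProbabilityMeasure_map (measurable_inner_left θ).aemeasurable

theorem MemW2.slice {σ : Measure (EuclideanSpace ℝ (Fin n))} (hσ : MemW2 σ)
    {θ : EuclideanSpace ℝ (Fin n)} (hθ : ‖θ‖ = 1) : MemW2 (slice σ θ) := by
  have := hσ.1
  refine ⟨isProbabilityMeasure_slice θ, ?_⟩
  rw [SliceMatching.slice, lintegral_map (by fun_prop) (measurable_inner_left θ)]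
  refine (lintegral_mono fun x => pow_le_pow_left' ?_ 2).trans_lt hσ.2
  rw [enorm_le_iff_norm_le]
  simpa [hθ] using norm_inner_le_norm (𝕜 := ℝ) x θ

/-- Fibres of the projection are affine hyperplanes, hence Lebesgue null. -/
theorem nullSingletonClass_slice {σ : Measure (EuclideanSpace ℝ (Fin n))} (hσ : σ ≪ volume)
    {θ : EuclideanSpace ℝ (Fin n)} (hθ : ‖θ‖ = 1) : NullSingletonClass (slice σ θ) := by
  refine ⟨fun t => ?_⟩
  rw [slice, Measure.map_apply (measurable_inner_left θ) (measurableSet_singleton t)]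
  refine hσ ?_
  have key := Measure.addHaar_affineSubspace
    (volume : Measure (EuclideanSpace ℝ (Fin n)))
    (AffineSubspace.mk' (t • θ) (LinearMap.ker (innerSL ℝ θ).toLinearMap)) (fun h => by
      -- The hyperplane at height `t` is proper, since it misses `(t + 1) • θ`.
      have h0 : (t + 1) • θ ∈ AffineSubspace.mk' (t • θ)
          (LinearMap.ker (innerSL ℝ θ).toLinearMap) := h ▸ AffineSubspace.mem_top ℝ _ _
      rw [AffineSubspace.mem_mk', vsub_eq_sub, ← sub_smul, LinearMap.mem_ker] at h0
      simp at h0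
      simp [h0] at hθ)
  refine measure_mono_null (fun x hx => ?_) key
  simp only [mem_preimage, mem_singleton_iff] at hx
  rw [SetLike.mem_coe, AffineSubspace.mem_mk', vsub_eq_sub, LinearMap.mem_ker]
  rw [real_inner_comm] at hx
  simp [inner_sub_right, inner_smul_right, hx, hθ]

theorem sum_W2_slice_sq_le (P : Matrix.orthogonalGroup (Fin n) ℝ)
    (σ μ : Measure (EuclideanSpace ℝ (Fin n))) :
    ∑ i, W2 (slice σ (column P i)) (slice μ (column P i)) ^ 2 ≤ W2 σ μ ^ 2 := by
  refine le_W2_sq fun π hπ => ?_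
  simp_rw [enorm_sq_eq_sum_inner P]
  rw [lintegral_finsetSum _ (fun i _ => by fun_prop)]
  refine Finset.sum_le_sum fun i _ => ?_
  have h := W2_sq_map_le (m := π) (f := fun p => (inner ℝ p.1 (column P i) : ℝ))
    (g := fun p => (inner ℝ p.2 (column P i) : ℝ)) (by fun_prop) (by fun_prop)
  have h1 : π.map (fun p => (inner ℝ p.1 (column P i) : ℝ)) = slice σ (column P i) := by
    rw [slice, ← hπ.1, Measure.map_map (measurable_inner_left _) measurable_fst]; rfl
  have h2 : π.map (fun p => (inner ℝ p.2 (column P i) : ℝ)) = slice μ (column P i) := by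
    rw [slice, ← hπ.2, Measure.map_map (measurable_inner_left _) measurable_snd]; rfl
  rw [h1, h2] at h
  simpa only [inner_sub_left] using h

theorem inner_sliceMatchingMap {σ μ : Measure (EuclideanSpace ℝ (Fin n))}
    (P : Matrix.orthogonalGroup (Fin n) ℝ) (j : ℕ) (x : EuclideanSpace ℝ (Fin n)) (i : Fin n) :
    (inner ℝ (sliceMatchingMap σ μ P j x) (column P i) : ℝ) =
      if i.val < j then
        otMap (slice σ (column P i)) (slice μ (column P i)) (inner ℝ x (column P i))
      else inner ℝ x (column P i) := by
  have ho := orthonormal_iff_ite.1 (orthonormal_column P)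
  simp only [sliceMatchingMap, inner_add_left, sum_inner, inner_smul_left, ho]
  by_cases h : i.val < j <;> simp [h]

theorem measurable_sliceMatchingMap {σ μ : Measure (EuclideanSpace ℝ (Fin n))}
    {P : Matrix.orthogonalGroup (Fin n) ℝ} {j : ℕ}
    (h : ∀ i, Measurable (otMap (slice σ (column P i)) (slice μ (column P i)))) :
    Measurable (sliceMatchingMap σ μ P j) := by
  unfold sliceMatchingMap
  refine Measurable.add (Finset.measurable_fun_sum _ fun i _ => ?_)
    (Finset.measurable_fun_sum _ fun i _ => by fun_prop)
  exact ((h i).comp (measurable_inner_left _)).smul_const _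

/-- The distance travelled in one relaxed slice-matching step. -/
theorem W2_sq_map_sliceMatchingMap {σ μ : Measure (EuclideanSpace ℝ (Fin n))}
    (hσ : MemW2ac σ) (hμ : MemW2 μ) (P : Matrix.orthogonalGroup (Fin n) ℝ) (j : ℕ) {γ : ℝ}
    (hγ : γ ∈ Icc (0 : ℝ) 1) :
    W2 (σ.map fun x => (1 - γ) • x + γ • sliceMatchingMap σ μ P j x) σ ^ 2 =
      ENNReal.ofReal (γ ^ 2) * ∑ i ∈ Finset.univ.filter (fun i : Fin n => i.val < j),
        W2 (slice σ (column P i)) (slice μ (column P i)) ^ 2 := by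
  have := hσ.1.1
  have := hμ.1
  have hθ : ∀ i, ‖column P i‖ = 1 := (orthonormal_column P).1
  have := fun i => nullSingletonClass_slice hσ.2 (hθ i)
  have := fun i => isProbabilityMeasure_slice (σ := σ) (column P i)
  have := fun i => isProbabilityMeasure_slice (σ := μ) (column P i)
  have hot := fun i =>
    isOptimalTransportMap_otMap (slice σ (column P i)) (slice μ (column P i))
  have hcost := fun i => lintegral_otMap (slice σ (column P i)) (slice μ (column P i))
  have hT := measurable_sliceMatchingMap (j := j) fun i => (hot i).1
  have hS : Measurable fun x => (1 - γ) • x + γ • sliceMatchingMap σ μ P j x := by fun_prop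
  have hγsq : ENNReal.ofReal (γ ^ 2) = ENNReal.ofReal γ ^ 2 := ENNReal.ofReal_pow hγ.1 2
  rw [Finset.mul_sum, hγsq]
  apply le_antisymm
  · have h := W2_sq_map_le (m := σ) hS measurable_id
    rw [Measure.map_id] at h
    refine h.trans ?_
    simp_rw [enorm_sq_eq_sum_inner P]
    rw [lintegral_finsetSum _ (fun i _ => by fun_prop), Finset.sum_filter]
    refine Finset.sum_le_sum fun i _ => ?_
    have hdiff : ∀ x, (inner ℝ ((1 - γ) • x + γ • sliceMatchingMap σ μ P j x - id x)
        (column P i) : ℝ) = γ * ((inner ℝ (sliceMatchingMap σ μ P j x) (column P i) : ℝ) -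
          inner ℝ x (column P i)) := fun x => by
      simp only [id, inner_sub_left, inner_add_left, real_inner_smul_left]
      ring
    simp_rw [hdiff, inner_sliceMatchingMap]
    split_ifs with hij
    · rw [← hcost, ← lintegral_const_mul _ (by have := (hot i).1; fun_prop)]
      conv_rhs => rw [slice]
      rw [lintegral_map (by have := (hot i).1; fun_prop) (measurable_inner_left _)]
      simp_rw [enorm_mul, mul_pow, Real.enorm_of_nonneg hγ.1]
      exact le_rfl
    · simp
  · refine le_trans ?_ (sum_W2_slice_sq_le P _ σ)
    refine (Finset.sum_le_sum fun i hi => ?_).trans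
      (Finset.sum_le_sum_of_subset (Finset.filter_subset _ _))
    have hij : i.val < j := (Finset.mem_filter.1 hi).2
    rw [← mul_pow]
    refine pow_le_pow_left' ?_ 2
    have h := mul_W2_le_W2_interpolation (hot i).1 (hot i).2.1 (hcost i)
      (W2_lt_top (hσ.1.slice (hθ i)) (hμ.slice (hθ i))).ne hγ
    have hm : Measurable fun t : ℝ => (1 - γ) • t +
        γ • otMap (slice σ (column P i)) (slice μ (column P i)) t := by
      have := (hot i).1
      fun_prop
    -- The step map moves the `i`-th coordinate as a function of that coordinate alone, so slicing
    -- commutes with interpolating.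
    refine h.trans_eq (congrArg (W2 · _) ?_)
    change Measure.map _ (Measure.map _ σ) = Measure.map _ (Measure.map _ σ)
    rw [Measure.map_map hm (measurable_inner_left _), Measure.map_map (measurable_inner_left _) hS]
    congr 1
    ext x
    simp [inner_add_left, real_inner_smul_left, inner_sliceMatchingMap, hij]

end Slices

end SliceMatching

theorem mainTheorem3 {n : ℕ} (j : ℕ) (hj : 1 ≤ j) (hjn : j ≤ n)
    (σ₀ μ : MeasureTheory.Measure (EuclideanSpace ℝ (Fin n)))
    (hσ₀ : SliceMatching.MemW2ac σ₀) (hμ : SliceMatching.MemW2 μ)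
    (P : ℕ → Matrix.orthogonalGroup (Fin n) ℝ)
    (γ : ℕ → ℝ) (hγ : ∀ k, γ k ∈ Set.Icc (0 : ℝ) 1)
    (k : ℕ) (hk : SliceMatching.MemW2ac (SliceMatching.sliceIter σ₀ μ P γ j k)) :
    SliceMatching.W2 (SliceMatching.sliceIter σ₀ μ P γ j (k + 1))
        (SliceMatching.sliceIter σ₀ μ P γ j k) ^ 2 =
      ENNReal.ofReal (γ k ^ 2) *
        ∑ i ∈ Finset.univ.filter (fun i : Fin n => i.val < j),
          SliceMatching.W2
            (SliceMatching.slice (SliceMatching.sliceIter σ₀ μ P γ j k)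
              (SliceMatching.column (P k) i))
            (SliceMatching.slice μ (SliceMatching.column (P k) i)) ^ 2 :=
  SliceMatching.W2_sq_map_sliceMatchingMap hk hμ (P k) j (hγ k)
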